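/- Let $(\theta_m)_{m\ge 1}$ be complex numbers and let $g_\Theta(t)=\sum_{m\ge1}\frac{\theta_m}{m}t^m$. Assume that this power series has radius of convergence $1$ and that $g_\Theta$ extends continuously from the open unit disc to the punctured closed disc $\{t\in\mathbb{C}:|t|\le 1,\ t\ne 1\}$; the extension is again denoted by $g_\Theta$. Let $k\ge1$ be an integer and $P(r)=\frac{r^{k+1}}{k+1}+\sum_{j=0}^{k}c_jr^j$ with $c_0,\dots,c_k\in\mathbb{R}$, and assume that $$g_\Theta(e^{-w})=P(-\log w)+O(w)\qquad\text{as } w\to0,\ w\neq 0,\ |\arg w|\le \pi/2,$$ where $\log$ is the principal branch. Then for every real $v>0$, as $n\to\infty$, $$[t^n]\exp\bigl(v\,g_\Theta(t)\bigr)=\frac{\exp\bigl(vP(r)+ne^{-r}\bigr)}{e^{r}\sqrt{2\pi vP''(r)+2\pi ne^{-r}}}\Bigl(1+O\bigl(\log^{-k/2}n\bigr)\Bigr),$$ where $[t^n]$ denotes the $n$-th coefficient of the power series expansion at $0$, and $r=r(n,v)$ is any real solution of $$vP'(r)=ne^{-r},$$ which exists for all sufficiently large $n$. Furthermore, for any fixed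 $1\le v_1<v_2<\infty$ the error term is uniform in $v\in[v_1,v_2]$: the implied constant, and the bound from which on $n$ is large enough for the solution to exist and for the estimate to hold, do not depend on $v\in[v_1,v_2]$. -/

import Mathlib

open Filter Topology Asymptotics

noncomputable section

/-- The coefficients `θ_m / m`, `m ≥ 1`, of the generating function of the cycle weights `θ`;
the coefficient of index `0` is `θ 0 / 0 = 0`, so the value `θ 0` plays no role. -/
def cycleCoeff (θ : ℕ → ℂ) (m : ℕ) : ℂ := θ m / (m : ℂ)

/-- `g_Θ(t) = ∑_{m ≥ 1} (θ_m / m) t ^ m`, as the sum of its power series. -/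
def gTheta (θ : ℕ → ℂ) (t : ℂ) : ℂ := ∑' m : ℕ, cycleCoeff θ m * t ^ m

/-- The radius of convergence of the power series `∑_{m ≥ 1} (θ_m / m) t ^ m`. -/
def gThetaRadius (θ : ℕ → ℂ) : ENNReal :=
  (FormalMultilinearSeries.ofScalars ℂ (cycleCoeff θ)).radius

/-- The extraction symbol `[t^n] f(t)`: the `n`-th coefficient of the power series expansion
at `0` of a function `f` that is analytic at `0`. -/
def extractCoeff (n : ℕ) (f : ℂ → ℂ) : ℂ := iteratedDeriv n f 0 / (n.factorial : ℂ)

/-- The real polynomial `P(r) = r ^ (k + 1) / (k + 1) + ∑_{j = 0}^{k} c_j r ^ j`. -/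
def saddlePoly (k : ℕ) (c : ℕ → ℝ) : Polynomial ℝ :=
  Polynomial.C (1 / ((k : ℝ) + 1)) * Polynomial.X ^ (k + 1)
    + ∑ j ∈ Finset.range (k + 1), Polynomial.C (c j) * Polynomial.X ^ j

/-- `r` is a (real) solution of the saddle point equation `v P'(r) = n e^{-r}`. -/
def IsSaddle (P : Polynomial ℝ) (v : ℝ) (n : ℕ) (r : ℝ) : Prop :=
  v * P.derivative.eval r = (n : ℝ) * Real.exp (-r)

/-- The main term
`exp (v P(r) + n e^{-r}) / (e^r √(2π v P''(r) + 2π n e^{-r}))`. -/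
def saddleMainTerm (P : Polynomial ℝ) (v : ℝ) (n : ℕ) (r : ℝ) : ℝ :=
  Real.exp (v * P.eval r + (n : ℝ) * Real.exp (-r)) /
    (Real.exp r * Real.sqrt (2 * Real.pi * v * P.derivative.derivative.eval r
      + 2 * Real.pi * (n : ℝ) * Real.exp (-r)))

/-- The expansion `[t^n] exp (v g_Θ(t)) = (main term) * (1 + O(log^{-k/2} n))` as `n → ∞`,
uniformly for `v ∈ S`: the constant `C` and the threshold `N` do not depend on `v ∈ S`.
For `n ≥ N` the saddle point equation is solvable, and the expansion holds for each of its
solutions `r`. -/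
def SaddleExpansionOn (θ : ℕ → ℂ) (k : ℕ) (P : Polynomial ℝ) (S : Set ℝ) : Prop :=
  ∃ (C : ℝ) (N : ℕ), ∀ n : ℕ, N ≤ n → ∀ v ∈ S,
    (∃ r : ℝ, IsSaddle P v n r) ∧
    ∀ r : ℝ, IsSaddle P v n r →
      ∃ ε : ℂ, ‖ε‖ ≤ C * Real.log n ^ (-(k : ℝ) / 2) ∧
        extractCoeff n (fun t => Complex.exp ((v : ℂ) * gTheta θ t))
          = (saddleMainTerm P v n r : ℂ) * (1 + ε)

end

section

open Polynomial

/-! This is a saddle point argument. Apply Cauchy's formula on the circle of radius `exp (-e^{-r})`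
and write `t = e^{-w}` with `w = e^{-r} (1 + iτ)`, `|τ| ≤ π e^r`. Then `-log w = r - log (1 + iτ)`,
and the saddle equation cancels the linear term in `τ`. Since `log (1 + iτ) = iτ + τ²/2 + ⋯`, the
exponent is `-A τ²/2` with `A = v (P'(r) + P''(r))`, up to `O(r^k |τ|³ + e^{-r})`
(`exists_saddleExponent_add_le`).

Away from `τ = 0` the integrand is small (`exists_saddleExponent_re_le`). While `w` is small, the
real shift `log |1 + iτ|` lowers `P` by order `r^k log (1 + τ²)`, and the rotation by the argument
costs one power of `r` less. For the remaining `w`, `g_Θ` is bounded by compactness whereas `P(r)`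
has order `r^{k+1}`.

With `Y = r^{k/2}`, both facts combine into one pointwise bound `B Y⁻¹ (1 + Y² τ²)⁻¹` for the
distance to the Gaussian. It integrates to `O(Y⁻²)`; the Gaussian integral has order `Y⁻¹`, so the
relative error is `O(r^{-k/2})`, and `log n ≤ 2r` converts this to powers of `log n`. All constants
depend on `v` only through the interval containing it. -/

/-! ### Elementary estimates for the exponential, logarithm and argument -/

/-- Mean value inequality on a half-plane; it retains the common decay factor when the integrand is
compared with the Gaussian. -/
theorem norm_exp_sub_exp_le {x y : ℂ} {m : ℝ} (hx : x.re ≤ m) (hy : y.re ≤ m) :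
    ‖Complex.exp x - Complex.exp y‖ ≤ Real.exp m * ‖x - y‖ := by
  refine (convex_halfSpace_re_le m).norm_image_sub_le_of_norm_deriv_le
    (fun z _ => Complex.differentiable_exp.differentiableAt) (fun z hz => ?_) hy hx
  rw [Complex.deriv_exp, Complex.norm_exp]
  exact Real.exp_le_exp.2 hz

theorem norm_log_one_add_sub_sub_le {z : ℂ} (hz : ‖z‖ ≤ 1 / 2) :
    ‖Complex.log (1 + z) - (z - z ^ 2 / 2)‖ ≤ ‖z‖ ^ 3 := by
  have h := Complex.norm_log_sub_logTaylor_le 2 (z := z) (by linarith)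
  have e : Complex.logTaylor (2 + 1) z = z - z ^ 2 / 2 := by
    simp [Complex.logTaylor, Finset.sum_range_succ]; ring
  rw [e] at h
  refine h.trans ?_
  have h2 : (1 - ‖z‖)⁻¹ ≤ 2 := by
    rw [inv_le_comm₀ (by linarith) (by norm_num)]; linarith
  have h3 : 0 ≤ ‖z‖ ^ 3 := by positivity
  norm_num
  nlinarith [mul_le_mul_of_nonneg_left h2 h3]

theorem norm_log_one_add_sub_le {z : ℂ} (hz : ‖z‖ ≤ 1 / 2) :
    ‖Complex.log (1 + z) - z‖ ≤ ‖z‖ ^ 2 := by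
  refine (Complex.norm_log_one_add_sub_self_le (by linarith)).trans ?_
  have h2 : (1 - ‖z‖)⁻¹ ≤ 2 := by
    rw [inv_le_comm₀ (by linarith) (by norm_num)]; linarith
  nlinarith [mul_le_mul_of_nonneg_left h2 (sq_nonneg ‖z‖)]

theorem norm_log_one_add_le_two_mul {z : ℂ} (hz : ‖z‖ ≤ 1 / 2) :
    ‖Complex.log (1 + z)‖ ≤ 2 * ‖z‖ := by
  have := Complex.norm_log_one_add_half_le_self hz
  linarith [norm_nonneg z]

theorem norm_one_add_mul_I_sq (τ : ℝ) : ‖(1 + τ * Complex.I : ℂ)‖ ^ 2 = 1 + τ ^ 2 := by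
  rw [← Complex.normSq_eq_norm_sq, Complex.normSq_apply]; simp; ring

theorem log_norm_one_add_mul_I (τ : ℝ) :
    Real.log ‖(1 + τ * Complex.I : ℂ)‖ = Real.log (1 + τ ^ 2) / 2 := by
  rw [← norm_one_add_mul_I_sq, Real.log_pow]; push_cast; ring

/-- Jordan's inequality gives `|arg| ≤ 2 |sin arg|`, and `sin² arg = τ² / (1 + τ²)`. The bound lets
the cost of the rotation be absorbed by the gain from the modulus. -/
theorem arg_one_add_mul_I_sq_le (τ : ℝ) :
    (1 + τ * Complex.I : ℂ).arg ^ 2 ≤ 4 * Real.log (1 + τ ^ 2) := by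
  set z : ℂ := 1 + τ * Complex.I with hz
  have hre : 0 ≤ z.re := by simp [hz]
  have harg : |z.arg| ≤ Real.pi / 2 := Complex.abs_arg_le_pi_div_two_iff.2 hre
  have h1 : 2 / Real.pi * |z.arg| ≤ |Real.sin z.arg| := Real.mul_abs_le_abs_sin harg
  have h2 : Real.sin z.arg ^ 2 = τ ^ 2 / (1 + τ ^ 2) := by
    rw [Complex.sin_arg, div_pow, hz, norm_one_add_mul_I_sq]; simp
  have h3 : τ ^ 2 / (1 + τ ^ 2) ≤ Real.log (1 + τ ^ 2) := by
    have := Real.one_sub_inv_le_log_of_pos (x := 1 + τ ^ 2) (by positivity)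
    refine le_trans (le_of_eq ?_) this
    field_simp; ring
  have hpi := Real.pi_pos
  have h4 : |z.arg| ≤ 2 * |Real.sin z.arg| := by
    have : |z.arg| ≤ Real.pi / 2 * |Real.sin z.arg| := by
      calc |z.arg| = Real.pi / 2 * (2 / Real.pi * |z.arg|) := by field_simp
        _ ≤ _ := by gcongr
    refine this.trans ?_
    gcongr
    linarith [Real.pi_le_four]
  calc z.arg ^ 2 = |z.arg| ^ 2 := (sq_abs _).symm
    _ ≤ (2 * |Real.sin z.arg|) ^ 2 := by gcongr
    _ = 4 * (τ ^ 2 / (1 + τ ^ 2)) := by rw [mul_pow, sq_abs, h2]; norm_num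
    _ ≤ _ := by gcongr

/-! ### Comparison with a Gaussian integral -/

/-- With `q = κ Y²`, the factor `(1 + τ²)^{-q}` compensates cubic growth on the scale `1 / Y`. -/
theorem cubic_mul_exp_neg_log_le {κ Y ρ τ : ℝ} (hκ : 0 < κ) (hκ1 : κ ≤ 1) (hY : 0 < Y)
    (hq : 3 ≤ κ * Y ^ 2) (hρ : ρ ≤ 1 / Y) :
    (Y ^ 2 * |τ| ^ 3 + ρ) * Real.exp (-(κ * Y ^ 2) * Real.log (1 + τ ^ 2)) ≤
      2 * (3 / κ) ^ 3 / Y * (1 + Y ^ 2 * τ ^ 2)⁻¹ := by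
  set u := Y ^ 2 * τ ^ 2 with hu
  have hu0 : 0 ≤ u := by positivity
  -- Bernoulli's inequality, which needs the exponent `κ Y² / 3 ≥ 1`. Cubing it gives decay `(1 +
  -- u)⁻³`: two powers absorb the cubic growth, one remains integrable.
  have h1 : 1 + κ * Y ^ 2 / 3 * τ ^ 2 ≤ (1 + τ ^ 2) ^ (κ * Y ^ 2 / 3) :=
    one_add_mul_self_le_rpow_one_add (by nlinarith [sq_nonneg τ]) (by linarith)
  have h2 : κ / 3 * (1 + u) ≤ (1 + τ ^ 2) ^ (κ * Y ^ 2 / 3) := by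
    refine le_trans ?_ h1
    rw [hu]; nlinarith
  have h3 : Real.exp (-(κ * Y ^ 2) * Real.log (1 + τ ^ 2)) =
      (((1 + τ ^ 2) ^ (κ * Y ^ 2 / 3)) ^ 3)⁻¹ := by
    rw [Real.rpow_def_of_pos (by positivity), ← Real.exp_nat_mul, ← Real.exp_neg]
    congr 1; push_cast; ring
  have h4 : Real.exp (-(κ * Y ^ 2) * Real.log (1 + τ ^ 2)) ≤ ((κ / 3 * (1 + u)) ^ 3)⁻¹ := by
    rw [h3]
    gcongr
  have h5 : Y ^ 2 * |τ| ^ 3 + ρ ≤ 2 / Y * (1 + u) ^ 2 := by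
    have e : Y ^ 2 * |τ| ^ 3 = 1 / Y * (Y * |τ|) ^ 3 := by field_simp
    have hu' : u = (Y * |τ|) ^ 2 := by rw [mul_pow, sq_abs]
    have ht : 0 ≤ Y * |τ| := by positivity
    generalize Y * |τ| = t at *
    have a1 : t ^ 3 ≤ (1 + u) ^ 2 := by
      rw [hu']; nlinarith [sq_nonneg (t - 1), sq_nonneg (t ^ 2), mul_nonneg ht (sq_nonneg (t-1)), sq_nonneg (t ^ 2 - t)]
    have a2 : 1 ≤ (1 + u) ^ 2 := by nlinarith
    have a3 : 0 < 1 / Y := by positivity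
    rw [e]
    calc 1 / Y * t ^ 3 + ρ ≤ 1 / Y * (1 + u) ^ 2 + 1 / Y * (1 + u) ^ 2 := by
          gcongr
          nlinarith
      _ = _ := by ring
  calc _ ≤ 2 / Y * (1 + u) ^ 2 * ((κ / 3 * (1 + u)) ^ 3)⁻¹ := by
        gcongr
    _ = _ := by
      have : 1 + u ≠ 0 := by positivity
      field_simp

theorem integral_inv_one_add_mul_sq {Y : ℝ} (hY : 0 < Y) :
    ∫ τ : ℝ, (1 + Y ^ 2 * τ ^ 2)⁻¹ = Real.pi / Y := by
  have := MeasureTheory.Measure.integral_comp_mul_left (fun x : ℝ => (1 + x ^ 2)⁻¹) Y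
  simp only [mul_pow] at this
  rw [this, integral_univ_inv_one_add_sq, abs_of_pos (by positivity), smul_eq_mul]
  ring

theorem integrable_inv_one_add_mul_sq {Y : ℝ} (hY : 0 < Y) :
    MeasureTheory.Integrable fun τ : ℝ => (1 + Y ^ 2 * τ ^ 2)⁻¹ := by
  have := integrable_inv_one_add_sq.comp_mul_left' hY.ne'
  simpa only [mul_pow] using this

/-- Comparison of an integral over `[-T, T]` with a Gaussian integral. -/
theorem norm_integral_sub_gaussian_le {h : ℝ → ℂ} {T A B Y : ℝ} (hT : 0 ≤ T) (hA : 0 < A)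
    (hY : 0 < Y) (hh : Continuous h)
    (h1 : ∀ τ, |τ| ≤ T → ‖h τ - Real.exp (-(A / 2) * τ ^ 2)‖ ≤ B * (1 + Y ^ 2 * τ ^ 2)⁻¹)
    (h2 : ∀ τ, T ≤ |τ| → Real.exp (-(A / 2) * τ ^ 2) ≤ B * (1 + Y ^ 2 * τ ^ 2)⁻¹) :
    ‖(∫ τ in (-T)..T, h τ) - (Real.sqrt (2 * Real.pi / A) : ℝ)‖ ≤ B * (Real.pi / Y) := by
  have hg : MeasureTheory.Integrable fun τ : ℝ => (Real.exp (-(A / 2) * τ ^ 2) : ℂ) :=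
    (integrable_exp_neg_mul_sq (half_pos hA)).ofReal
  have hgi : ∫ τ : ℝ, (Real.exp (-(A / 2) * τ ^ 2) : ℂ) = (Real.sqrt (2 * Real.pi / A) : ℝ) := by
    have := integral_gaussian (A / 2)
    rw [show Real.pi / (A / 2) = 2 * Real.pi / A by field_simp] at this
    rw [← this]
    exact integral_ofReal
  -- Cutting `h` off outside `(-T, T]` turns the difference into one integral over the line, which
  -- includes the Gaussian tail.
  have hi : MeasureTheory.Integrable ((Set.Ioc (-T) T).indicator h) :=
    (MeasureTheory.integrable_indicator_iff measurableSet_Ioc).2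
      (hh.integrableOn_Ioc)
  rw [intervalIntegral.integral_of_le (by linarith), ← hgi,
    ← MeasureTheory.integral_indicator measurableSet_Ioc, ← MeasureTheory.integral_sub hi hg,
    ← integral_inv_one_add_mul_sq hY, ← MeasureTheory.integral_const_mul]
  refine MeasureTheory.norm_integral_le_of_norm_le
    ((integrable_inv_one_add_mul_sq hY).const_mul B) (Filter.Eventually.of_forall fun τ => ?_)
  by_cases hτ : τ ∈ Set.Ioc (-T) T
  · rw [Set.indicator_of_mem hτ]
    exact h1 τ (abs_le.2 ⟨hτ.1.le, hτ.2⟩)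
  · rw [Set.indicator_of_notMem hτ, zero_sub, norm_neg, Complex.norm_real, Real.norm_eq_abs,
      abs_of_pos (Real.exp_pos _)]
    refine h2 τ ?_
    by_contra hc
    push Not at hc
    rw [abs_lt] at hc
    exact hτ ⟨hc.1, hc.2.le⟩

/-! ### Taylor expansion and growth of `P` -/

theorem natDegree_saddlePoly_le (k : ℕ) (c : ℕ → ℝ) : (saddlePoly k c).natDegree ≤ k + 1 := by
  unfold saddlePoly
  refine (natDegree_add_le _ _).trans (max_le (natDegree_C_mul_X_pow_le _ _) ?_)
  refine natDegree_sum_le_of_forall_le _ _ fun j hj => (natDegree_C_mul_X_pow_le _ _).trans ?_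
  have := Finset.mem_range.1 hj; omega

/-- Taylor expansion of order `m` of a real polynomial at `s ≥ 1`, with a uniform remainder. -/
theorem exists_taylor_remainder_le (p : ℝ[X]) (d m : ℕ) (hd : p.natDegree ≤ d + m) :
    ∃ C : ℝ, 0 ≤ C ∧ ∀ s : ℝ, 1 ≤ s → ∀ h : ℂ, ‖h‖ ≤ 2 →
      ‖aeval ((s : ℂ) + h) p - ∑ j ∈ Finset.range m, (((hasseDeriv j p).eval s : ℝ) : ℂ) * h ^ j‖ ≤
        C * s ^ d * ‖h‖ ^ m := by
  have hb : ∀ q : ℝ[X], q.natDegree ≤ d → ∃ C : ℝ, 0 ≤ C ∧ ∀ s : ℝ, 1 ≤ s →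
      |q.eval s| ≤ C * s ^ d := by
    intro q hq
    refine ⟨∑ i ∈ Finset.range (d + 1), |q.coeff i|, by positivity, fun s hs => ?_⟩
    rw [eval_eq_sum_range' (Nat.lt_succ_of_le hq), Finset.sum_mul]
    refine (Finset.abs_sum_le_sum_abs _ _).trans (Finset.sum_le_sum fun i hi => ?_)
    rw [abs_mul, abs_of_nonneg (by positivity : 0 ≤ s ^ i)]
    have := Finset.mem_range.1 hi
    exact mul_le_mul_of_nonneg_left (pow_le_pow_right₀ hs (by omega)) (abs_nonneg _)
  choose! C hC0 hC using hb
  have hdeg : ∀ j, (hasseDeriv (m + j) p).natDegree ≤ d := fun j =>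
    (natDegree_hasseDeriv_le p (m + j)).trans (by omega)
  -- Each coefficient of order at least `m` has degree at most `d` in `s`; the factors `2 ^ j` come
  -- from `‖h‖ ≤ 2`.
  refine ⟨∑ j ∈ Finset.range (d + 1), C (hasseDeriv (m + j) p) * 2 ^ j,
    Finset.sum_nonneg fun j _ => mul_nonneg (hC0 _ (hdeg j)) (by positivity), fun s hs h hh => ?_⟩
  have e : aeval ((s : ℂ) + h) p =
      ∑ j ∈ Finset.range (m + (d + 1)), (((hasseDeriv j p).eval s : ℝ) : ℂ) * h ^ j := by
    have h1 : aeval ((s : ℂ) + h) p = aeval h (taylor s p) := by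
      rw [taylor_apply, aeval_comp]
      congr 1
      simp [add_comm]
    rw [h1, aeval_eq_sum_range' (n := m + (d + 1)) (by rw [natDegree_taylor]; omega)]
    refine Finset.sum_congr rfl fun j _ => ?_
    rw [taylor_coeff, Complex.real_smul]
  rw [e, Finset.sum_range_add, add_sub_cancel_left, Finset.sum_mul, Finset.sum_mul]
  refine (norm_sum_le _ _).trans (Finset.sum_le_sum fun j _ => ?_)
  rw [norm_mul, norm_pow, Complex.norm_real, Real.norm_eq_abs, pow_add]
  calc |(hasseDeriv (m + j) p).eval s| * (‖h‖ ^ m * ‖h‖ ^ j)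
      ≤ (C (hasseDeriv (m + j) p) * s ^ d) * (‖h‖ ^ m * 2 ^ j) := by
        have := hC _ (hdeg j) s hs
        have := (abs_nonneg _).trans this
        gcongr
    _ = _ := by ring

theorem exists_abs_eval_le (p : ℝ[X]) (d : ℕ) (hd : p.natDegree ≤ d) :
    ∃ C : ℝ, 0 ≤ C ∧ ∀ s : ℝ, 1 ≤ s → |p.eval s| ≤ C * s ^ d := by
  obtain ⟨C, hC, h⟩ := exists_taylor_remainder_le p d 0 (by simpa using hd)
  refine ⟨C, hC, fun s hs => ?_⟩
  have := h s hs 0 (by simp)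
  simp only [add_zero, Finset.range_zero, Finset.sum_empty, sub_zero, pow_zero, mul_one] at this
  have e : aeval (s : ℂ) p = ((p.eval s : ℝ) : ℂ) := by
    simpa using aeval_algebraMap_apply ℂ s p
  rwa [e, Complex.norm_real, Real.norm_eq_abs] at this

theorem two_mul_hasseDeriv_two_eval (p : ℝ[X]) (s : ℝ) :
    2 * (hasseDeriv 2 p).eval s = p.derivative.derivative.eval s := by
  have := congrFun (factorial_smul_hasseDeriv (R := ℝ) 2) p
  simp only [Nat.factorial, LinearMap.smul_apply, Function.iterate_succ, Function.iterate_zero,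
    Function.comp_apply, id] at this
  rw [← this]; simp

/-- Meant for imaginary `h`, where the linear term has no real part. The remainder has one power of
`s` less than the `s ^ k` to be gained. -/
theorem exists_taylor_two_le (k : ℕ) (hk : 1 ≤ k) (c : ℕ → ℝ) :
    ∃ C : ℝ, 0 ≤ C ∧ ∀ s : ℝ, 1 ≤ s → ∀ h : ℂ, ‖h‖ ≤ 2 →
      ‖aeval ((s : ℂ) + h) (saddlePoly k c) - (((saddlePoly k c).eval s : ℝ) : ℂ)
        - (((saddlePoly k c).derivative.eval s : ℝ) : ℂ) * h‖ ≤ C * s ^ (k - 1) * ‖h‖ ^ 2 := by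
  obtain ⟨C, hC, h⟩ := exists_taylor_remainder_le (saddlePoly k c) (k - 1) 2
    ((natDegree_saddlePoly_le k c).trans (by omega))
  refine ⟨C, hC, fun s hs z hz => ?_⟩
  simpa [Finset.sum_range_succ, hasseDeriv_one, sub_sub] using h s hs z hz

theorem exists_taylor_three_le (k : ℕ) (c : ℕ → ℝ) :
    ∃ C : ℝ, 0 ≤ C ∧ ∀ s : ℝ, 1 ≤ s → ∀ h : ℂ, ‖h‖ ≤ 2 →
      ‖aeval ((s : ℂ) + h) (saddlePoly k c) - (((saddlePoly k c).eval s : ℝ) : ℂ)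
        - (((saddlePoly k c).derivative.eval s : ℝ) : ℂ) * h
        - (((saddlePoly k c).derivative.derivative.eval s : ℝ) : ℂ) * h ^ 2 / 2‖
        ≤ C * s ^ k * ‖h‖ ^ 3 := by
  obtain ⟨C, hC, h⟩ := exists_taylor_remainder_le (saddlePoly k c) k 3
    ((natDegree_saddlePoly_le k c).trans (by omega))
  refine ⟨C, hC, fun s hs z hz => ?_⟩
  have := h s hs z hz
  rw [← two_mul_hasseDeriv_two_eval]
  simp only [Finset.sum_range_succ, Finset.range_zero, Finset.sum_empty, hasseDeriv_zero',
    hasseDeriv_one', zero_add, pow_zero, pow_one, mul_one] at this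
  convert this using 2
  push_cast; ring

theorem natDegree_derivative_saddlePoly_sub_le (k : ℕ) (hk : 1 ≤ k) (c : ℕ → ℝ) :
    ((saddlePoly k c).derivative - X ^ k).natDegree ≤ k - 1 := by
  have e : (saddlePoly k c).derivative - X ^ k =
      ∑ j ∈ Finset.range (k + 1), derivative (C (c j) * X ^ j) := by
    unfold saddlePoly
    rw [derivative_add, derivative_C_mul_X_pow, derivative_sum]
    have : (1 / ((k : ℝ) + 1) * ((k + 1 : ℕ) : ℝ)) = 1 := by
      push_cast; field_simp
    rw [this]; simp
  rw [e]
  refine natDegree_sum_le_of_forall_le _ _ fun j hj => ?_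
  refine (natDegree_derivative_le _).trans (Nat.sub_le_sub_right ?_ 1)
  have := Finset.mem_range.1 hj
  exact (natDegree_C_mul_X_pow_le _ _).trans (by omega)

/-- Growth of the derivatives of `saddlePoly` from some point on. -/
theorem exists_saddlePoly_bounds (k : ℕ) (hk : 1 ≤ k) (c : ℕ → ℝ) :
    ∃ s₀ : ℝ, 1 ≤ s₀ ∧ ∀ s : ℝ, s₀ ≤ s →
      s ^ k / 2 ≤ (saddlePoly k c).derivative.eval s ∧
      (saddlePoly k c).derivative.eval s ≤ 2 * s ^ k ∧
      |(saddlePoly k c).derivative.derivative.eval s| ≤ s ^ k / 4 := by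
  obtain ⟨C₁, hC₁, h₁⟩ := exists_abs_eval_le _ _ (natDegree_derivative_saddlePoly_sub_le k hk c)
  obtain ⟨C₂, hC₂, h₂⟩ := exists_abs_eval_le (saddlePoly k c).derivative.derivative (k - 1) (by
    have h1 := natDegree_derivative_le (saddlePoly k c).derivative
    have h2 := natDegree_derivative_le (saddlePoly k c)
    have h3 := natDegree_saddlePoly_le k c
    omega)
  refine ⟨1 + 2 * C₁ + 4 * C₂, by linarith, fun s hs => ?_⟩
  have hs1 : 1 ≤ s := by linarith
  have e : s ^ k = s * s ^ (k - 1) := by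
    rw [← pow_succ', Nat.sub_add_cancel hk]
  have hp : 0 ≤ s ^ (k - 1) := by positivity
  have g₁ := h₁ s hs1
  have g₂ := h₂ s hs1
  rw [eval_sub, eval_pow, eval_X, abs_le] at g₁
  have a1 : 2 * C₁ * s ^ (k - 1) ≤ s ^ k := by
    rw [e]; gcongr; linarith
  have a2 : 4 * C₂ * s ^ (k - 1) ≤ s ^ k := by
    rw [e]; gcongr; linarith
  have hk0 : 0 ≤ s ^ k := by positivity
  refine ⟨?_, ?_, ?_⟩ <;> linarith [g₁.1, g₁.2]

/-- Integrated form of `P'(u) ≥ u ^ k / 2`. -/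
theorem saddlePoly_sub_ge (k : ℕ) (c : ℕ → ℝ) {s₀ : ℝ}
    (h : ∀ s : ℝ, s₀ ≤ s → s ^ k / 2 ≤ (saddlePoly k c).derivative.eval s) {s r : ℝ}
    (hs : s₀ ≤ s) (hr : s ≤ r) :
    (r ^ (k + 1) - s ^ (k + 1)) / (2 * (k + 1)) ≤
      (saddlePoly k c).eval r - (saddlePoly k c).eval s := by
  have hm : MonotoneOn (fun u => (saddlePoly k c).eval u - u ^ (k + 1) / (2 * (k + 1)))
      (Set.Ici s₀) := by
    have hd : ∀ u : ℝ, HasDerivAt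
        (fun u => (saddlePoly k c).eval u - u ^ (k + 1) / (2 * (k + 1)))
        ((saddlePoly k c).derivative.eval u - u ^ k / 2) u := by
      intro u
      refine (((saddlePoly k c).hasDerivAt u).sub
        (((hasDerivAt_pow (k + 1) u)).div_const _)).congr_deriv ?_
      push_cast
      field_simp
    refine monotoneOn_of_deriv_nonneg (convex_Ici _)
      (fun u _ => (hd u).continuousAt.continuousWithinAt)
      (fun u _ => (hd u).differentiableAt.differentiableWithinAt) fun u hu => ?_
    rw [(hd u).deriv]
    rw [interior_Ici] at hu
    linarith [h u (le_of_lt hu)]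
  have := hm (Set.mem_Ici.2 hs) (Set.mem_Ici.2 (hs.trans hr)) hr
  simp only at this
  rw [sub_div]
  linarith

theorem mul_pow_le_pow_succ_sub (k : ℕ) {s r : ℝ} (hs : 0 ≤ s) (hr : s ≤ r) :
    (r - s) * r ^ k ≤ r ^ (k + 1) - s ^ (k + 1) := by
  have : s ^ k ≤ r ^ k := by gcongr
  rw [pow_succ, pow_succ]
  nlinarith

/-! ### Cauchy's formula in the scaled angle -/

theorem differentiableOn_gTheta {θ : ℕ → ℂ} (hrad : gThetaRadius θ = 1) :
    DifferentiableOn ℂ (gTheta θ) (Metric.ball 0 1) := by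
  have h := (FormalMultilinearSeries.ofScalars ℂ (cycleCoeff θ)).hasFPowerSeriesOnBall (by
    rw [show (FormalMultilinearSeries.ofScalars ℂ (cycleCoeff θ)).radius = 1 from hrad]
    exact one_pos)
  have e : (FormalMultilinearSeries.ofScalars ℂ (cycleCoeff θ)).sum = gTheta θ := by
    have := FormalMultilinearSeries.ofScalarsSum_eq_tsum (E := ℂ) (cycleCoeff θ)
    exact this
  rw [e, show (FormalMultilinearSeries.ofScalars ℂ (cycleCoeff θ)).radius = 1 from hrad] at h
  have := h.differentiableOn
  rwa [show Metric.eball (0 : ℂ) 1 = Metric.ball 0 1 by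
    rw [← ENNReal.ofReal_one, Metric.eball_ofReal]] at this

/-- The exponent of the integrand of the Cauchy integral on the circle of radius
`exp (-exp (-r))`, in the scaled angle and relative to its value at the saddle point. -/
noncomputable def saddleExponent (G : ℂ → ℂ) (P : ℝ[X]) (v r τ : ℝ) : ℂ :=
  v * (G (Complex.exp (-(Real.exp (-r) * (1 + τ * Complex.I)))) - (P.eval r : ℝ))
    + (v * P.derivative.eval r : ℝ) * (τ * Complex.I)

theorem norm_exp_neg_mul_one_add {ρ τ : ℝ} :
    ‖Complex.exp (-(ρ * (1 + τ * Complex.I)))‖ = Real.exp (-ρ) := by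
  rw [Complex.norm_exp]; simp

theorem continuous_saddleExponent {G : ℂ → ℂ}
    (hGcont : ContinuousOn G {t : ℂ | ‖t‖ ≤ 1 ∧ t ≠ 1}) (P : ℝ[X]) (v r : ℝ) :
    Continuous (saddleExponent G P v r) := by
  unfold saddleExponent
  have : Continuous fun τ : ℝ => G (Complex.exp (-(Real.exp (-r) * (1 + τ * Complex.I)))) := by
    refine hGcont.comp_continuous (by fun_prop) fun τ => ?_
    have h1 : ‖Complex.exp (-((Real.exp (-r) : ℝ) * (1 + τ * Complex.I)))‖ < 1 := by
      rw [norm_exp_neg_mul_one_add, Real.exp_lt_one_iff]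
      linarith [Real.exp_pos (-r)]
    refine ⟨h1.le, fun h => ?_⟩
    rw [h] at h1
    simp at h1
  exact (((this.sub continuous_const).const_mul _).add (by fun_prop))

/-- On the circle `t^{-n} = e^{nw}`, whose constant part joins the prefactor; the saddle equation
rewrites the rest, `n e^{-r} iτ`, as `v P'(r) iτ`. -/
theorem extractCoeff_eq_integral {θ : ℕ → ℂ} (hrad : gThetaRadius θ = 1) {G : ℂ → ℂ}
    (hG : ∀ t : ℂ, ‖t‖ < 1 → G t = gTheta θ t) {P : ℝ[X]} {v r : ℝ} {n : ℕ}
    (hr : IsSaddle P v n r) :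
    extractCoeff n (fun t => Complex.exp ((v : ℂ) * gTheta θ t)) =
      (Real.exp (-r) / (2 * Real.pi) * Real.exp (v * P.eval r + n * Real.exp (-r)) : ℝ) *
        ∫ τ in (-(Real.pi * Real.exp r))..(Real.pi * Real.exp r), Complex.exp (saddleExponent G P v r τ) := by
  set ρ := Real.exp (-r) with hρ
  have hρ0 : 0 < ρ := Real.exp_pos _
  have hR1 : Real.exp (-ρ) < 1 := by
    rw [Real.exp_lt_one_iff]; linarith
  set f : ℂ → ℂ := fun t => Complex.exp ((v : ℂ) * gTheta θ t) with hf
  set Ψ : ℝ → ℂ := fun y => f (circleMap 0 (Real.exp (-ρ)) y) /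
    (circleMap 0 (Real.exp (-ρ)) y) ^ n with hΨ
  have hdiff : DifferentiableOn ℂ f (Metric.closedBall 0 (Real.exp (-ρ))) :=
    (((differentiableOn_gTheta hrad).mono
      (Metric.closedBall_subset_ball hR1)).const_mul _).cexp
  have hC := hdiff.circleIntegral_one_div_sub_center_pow_smul (Real.exp_pos _) n
  have hcirc : (∮ z in C(0, Real.exp (-ρ)), (1 / (z - 0) ^ (n + 1)) • f z) =
      Complex.I * ∫ y in (0)..(2 * Real.pi), Ψ y := by
    rw [circleIntegral, ← intervalIntegral.integral_const_mul]
    refine intervalIntegral.integral_congr fun y _ => ?_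
    have : circleMap 0 (Real.exp (-ρ)) y ≠ 0 := circleMap_ne_center (Real.exp_pos _).ne'
    simp only [hΨ, deriv_circleMap, smul_eq_mul, sub_zero]
    field_simp
    ring
  have hper : Function.Periodic Ψ (2 * Real.pi) := fun y => by
    simp only [hΨ, periodic_circleMap 0 (Real.exp (-ρ)) y]
  have h1 : ∫ y in (0)..(2 * Real.pi), Ψ y = ∫ y in (-Real.pi)..Real.pi, Ψ y := by
    have := hper.intervalIntegral_add_eq 0 (-Real.pi)
    rw [zero_add] at this
    rw [this]; congr 1; ring
  -- The angle is `y = -ρ τ`, since `t = e^{-w}` reverses orientation.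
  have h2 : ∫ τ in (-(Real.pi * Real.exp r))..(Real.pi * Real.exp r), Ψ (-ρ * τ) =
      (ρ : ℂ)⁻¹ * ∫ y in (-Real.pi)..Real.pi, Ψ y := by
    rw [intervalIntegral.integral_comp_mul_left _ (neg_ne_zero.2 hρ0.ne')]
    have e : ρ * Real.exp r = 1 := by rw [hρ, ← Real.exp_add]; simp
    have e1 : -ρ * -(Real.pi * Real.exp r) = Real.pi := by linear_combination Real.pi * e
    have e2 : -ρ * (Real.pi * Real.exp r) = -Real.pi := by linear_combination -Real.pi * e
    rw [e1, e2, intervalIntegral.integral_symm, Complex.real_smul]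
    push_cast
    rw [inv_neg]; ring
  have h3 : ∀ τ : ℝ, Ψ (-ρ * τ) =
      (Real.exp (v * P.eval r + n * ρ) : ℝ) * Complex.exp (saddleExponent G P v r τ) := by
    intro τ
    have e : circleMap 0 (Real.exp (-ρ)) (-ρ * τ) =
        Complex.exp (-((ρ : ℝ) * (1 + τ * Complex.I))) := by
      rw [circleMap_zero]
      push_cast
      rw [← Complex.exp_add]; congr 1; ring
    have hn : (v * P.derivative.eval r : ℝ) = n * ρ := hr
    simp only [hΨ, hf, saddleExponent, e, ← hρ]
    rw [hG _ (by rw [norm_exp_neg_mul_one_add]; exact hR1), ← Complex.exp_nat_mul,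
      ← Complex.exp_sub, Complex.ofReal_exp (v * P.eval r + n * ρ), ← Complex.exp_add, hn]
    congr 1
    push_cast
    ring
  simp_rw [h3] at h2
  rw [intervalIntegral.integral_const_mul] at h2
  rw [hcirc, h1] at hC
  unfold extractCoeff
  have hfac : (n.factorial : ℂ) ≠ 0 := by exact_mod_cast n.factorial_ne_zero
  have hpi : (Real.pi : ℂ) ≠ 0 := by exact_mod_cast Real.pi_ne_zero
  have hρc : (ρ : ℂ) ≠ 0 := by exact_mod_cast hρ0.ne'
  have hI : ∫ y in (-Real.pi)..Real.pi, Ψ y =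
      2 * Real.pi / n.factorial * iteratedDeriv n f 0 := by
    apply mul_left_cancel₀ Complex.I_ne_zero
    rw [hC, smul_eq_mul]; ring
  rw [hI] at h2
  rw [Complex.ofReal_mul, mul_assoc, h2]
  push_cast
  field_simp

/-! ### Decay on the circle and local expansion of the exponent -/

theorem one_add_mul_I_ne_zero (τ : ℝ) : (1 + τ * Complex.I : ℂ) ≠ 0 := fun h => by
  simpa using congrArg Complex.re h

theorem neg_log_exp_neg_mul (r τ : ℝ) :
    -Complex.log (Real.exp (-r) * (1 + τ * Complex.I)) =
      r - Complex.log (1 + τ * Complex.I) := by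
  rw [Complex.log_ofReal_mul (Real.exp_pos _) (one_add_mul_I_ne_zero τ), Real.log_exp]
  push_cast; ring

theorem re_exp_neg_mul_one_add (r τ : ℝ) :
    ((Real.exp (-r) : ℝ) * (1 + τ * Complex.I) : ℂ).re = Real.exp (-r) := by
  rw [Complex.re_ofReal_mul]; simp

theorem im_exp_neg_mul_one_add (r τ : ℝ) :
    ((Real.exp (-r) : ℝ) * (1 + τ * Complex.I) : ℂ).im = Real.exp (-r) * τ := by
  rw [Complex.im_ofReal_mul]; simp

theorem norm_exp_neg_mul_one_add_mul_I (r τ : ℝ) :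
    ‖((Real.exp (-r) : ℝ) * (1 + τ * Complex.I) : ℂ)‖ =
      Real.exp (-(r - Real.log (1 + τ ^ 2) / 2)) := by
  rw [norm_mul, Complex.norm_real, Real.norm_eq_abs, abs_of_pos (Real.exp_pos _),
    ← log_norm_one_add_mul_I, neg_sub, Real.exp_sub,
    Real.exp_log (norm_pos_iff.2 (one_add_mul_I_ne_zero τ)), Real.exp_neg]
  ring

/-- Decay of the real part of `P (-log w)` along the vertical line through `exp (-r)`. -/
theorem exists_re_aeval_neg_log_le (k : ℕ) (hk : 1 ≤ k) (c : ℕ → ℝ) :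
    ∃ s₁ : ℝ, 1 ≤ s₁ ∧ ∀ r τ : ℝ, s₁ ≤ r - Real.log (1 + τ ^ 2) / 2 →
      (aeval (r - Complex.log (1 + τ * Complex.I) : ℂ) (saddlePoly k c)).re -
        (saddlePoly k c).eval r ≤ -(r ^ k / (8 * (k + 1)) * Real.log (1 + τ ^ 2)) := by
  obtain ⟨s₀, hs₀, hb⟩ := exists_saddlePoly_bounds k hk c
  obtain ⟨C, hC, hT⟩ := exists_taylor_two_le k hk c
  -- The second threshold makes the cost of the rotation at most half of the gain `r ^ k l / (4 (k +
  -- 1))`.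
  refine ⟨max s₀ (32 * C * (k + 1)), le_max_of_le_left hs₀, fun r τ hr => ?_⟩
  set l := Real.log (1 + τ ^ 2) with hl
  have hl0 : 0 ≤ l := Real.log_nonneg (by nlinarith [sq_nonneg τ])
  set s := r - l / 2 with hs
  have hs0 : s₀ ≤ s := (le_max_left _ _).trans hr
  have hs1 : 1 ≤ s := hs₀.trans hs0
  have hsr : s ≤ r := by rw [hs]; linarith
  set φ := (1 + τ * Complex.I : ℂ).arg with hφ
  have hφ2 : |φ| ≤ 2 := by
    have : |φ| ≤ Real.pi / 2 := Complex.abs_arg_le_pi_div_two_iff.2 (by simp)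
    linarith [Real.pi_le_four]
  -- The move is split into a real shift from `r` to `s` and an imaginary one by `-iφ`.
  have e : (r - Complex.log (1 + τ * Complex.I) : ℂ) = (s : ℂ) + (-φ * Complex.I) := by
    rw [Complex.log, log_norm_one_add_mul_I, hs]
    push_cast; ring
  have hnorm : ‖(-φ * Complex.I : ℂ)‖ = |φ| := by simp
  have h1 := hT s hs1 (-φ * Complex.I) (by rw [hnorm]; exact hφ2)
  rw [hnorm, sq_abs] at h1
  have h2 := (Complex.re_le_norm _).trans h1
  simp only [Complex.sub_re, Complex.ofReal_re, Complex.re_ofReal_mul] at h2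
  simp only [Complex.mul_re, Complex.neg_re, Complex.ofReal_re, Complex.I_re, Complex.I_im,
    Complex.neg_im, Complex.ofReal_im, mul_zero, neg_zero, zero_mul, sub_zero] at h2
  have h3 : φ ^ 2 ≤ 4 * l := arg_one_add_mul_I_sq_le τ
  have h4 := saddlePoly_sub_ge k c (fun s hs => (hb s hs).1) hs0 hsr
  have h5 := mul_pow_le_pow_succ_sub k (zero_le_one.trans hs1) hsr
  have h6 : (r - s) * r ^ k / (2 * (k + 1)) ≤
      (saddlePoly k c).eval r - (saddlePoly k c).eval s := by
    refine le_trans ?_ h4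
    gcongr
  have hrs : r - s = l / 2 := by rw [hs]; ring
  have hr1 : 1 ≤ r := hs1.trans hsr
  have h7 : C * s ^ (k - 1) * φ ^ 2 ≤ C * r ^ (k - 1) * (4 * l) := by gcongr
  have h8 : 32 * C * (k + 1) * r ^ (k - 1) ≤ r ^ k := by
    rw [show r ^ k = r * r ^ (k - 1) by rw [← pow_succ', Nat.sub_add_cancel hk]]
    gcongr
    exact (le_max_right _ _).trans (hr.trans hsr)
  have h9 : C * r ^ (k - 1) * (4 * l) ≤ r ^ k / (8 * (k + 1)) * l := by
    have : C * r ^ (k - 1) * 4 ≤ r ^ k / (8 * (k + 1)) := by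
      rw [le_div_iff₀ (by positivity)]
      linarith
    nlinarith
  rw [hrs] at h6
  rw [e]
  have h10 : l / 2 * r ^ k / (2 * (k + 1)) = 2 * (r ^ k / (8 * (k + 1)) * l) := by
    field_simp; ring
  linarith

theorem exists_norm_sub_aeval_le {G : ℂ → ℂ} {P : ℝ[X]}
    (hP : (fun w : ℂ => G (Complex.exp (-w)) - aeval (-Complex.log w) P)
      =O[𝓝[{w : ℂ | w ≠ 0 ∧ |Complex.arg w| ≤ Real.pi / 2}] 0] (fun w : ℂ => w)) :
    ∃ K δ : ℝ, 0 ≤ K ∧ 0 < δ ∧ ∀ w : ℂ, 0 < w.re → ‖w‖ ≤ δ →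
      ‖G (Complex.exp (-w)) - aeval (-Complex.log w) P‖ ≤ K * ‖w‖ := by
  obtain ⟨K, hK, h⟩ := hP.exists_nonneg
  rw [isBigOWith_iff, eventually_nhdsWithin_iff, Metric.eventually_nhds_iff] at h
  obtain ⟨δ, hδ, h⟩ := h
  refine ⟨K, δ / 2, hK, by positivity, fun w hw hwδ => h ?_ ⟨?_, ?_⟩⟩
  · rw [dist_zero_right]; linarith
  · rintro rfl; simp at hw
  · exact Complex.abs_arg_le_pi_div_two_iff.2 hw.le

/-- Compactness: `e^{-w} = 1` forces `w ∈ 2πiℤ`, and `|Im w| ≤ π` leaves only `w = 0`, which is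
excluded. -/
theorem exists_norm_le_of_le_norm {G : ℂ → ℂ}
    (hGcont : ContinuousOn G {t : ℂ | ‖t‖ ≤ 1 ∧ t ≠ 1}) {δ : ℝ} (hδ : 0 < δ) :
    ∃ M : ℝ, ∀ w : ℂ, δ ≤ ‖w‖ → 0 ≤ w.re → w.re ≤ 1 → |w.im| ≤ Real.pi →
      ‖G (Complex.exp (-w))‖ ≤ M := by
  set S : Set ℂ := {w | δ ≤ ‖w‖ ∧ 0 ≤ w.re ∧ w.re ≤ 1 ∧ |w.im| ≤ Real.pi} with hS
  have hc : IsCompact S := by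
    refine Metric.isCompact_of_isClosed_isBounded ?_ ?_
    · exact (isClosed_le continuous_const continuous_norm).inter
        ((isClosed_le continuous_const Complex.continuous_re).inter
          ((isClosed_le Complex.continuous_re continuous_const).inter
            (isClosed_le Complex.continuous_im.abs continuous_const)))
    · refine isBounded_iff_forall_norm_le.2 ⟨1 + Real.pi, fun w hw => ?_⟩
      refine (Complex.norm_le_abs_re_add_abs_im w).trans (add_le_add ?_ hw.2.2.2)
      rw [abs_of_nonneg hw.2.1]; exact hw.2.2.1
  have hcont : ContinuousOn (fun w => G (Complex.exp (-w))) S := by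
    refine hGcont.comp (by fun_prop) fun w hw => ⟨?_, fun h => ?_⟩
    · rw [Complex.norm_exp, Real.exp_le_one_iff]; simpa using hw.2.1
    · obtain ⟨n, hn⟩ := Complex.exp_eq_one_iff.1 h
      have him : -w.im = n * (2 * Real.pi) := by simpa using congrArg Complex.im hn
      have hre : w.re = 0 := by simpa using congrArg Complex.re hn
      have hpi := Real.pi_pos
      have h2 : |(n : ℝ)| * (2 * Real.pi) ≤ Real.pi := by
        rw [← abs_of_pos (by positivity : 0 < 2 * Real.pi), ← abs_mul, ← him, abs_neg]
        exact hw.2.2.2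
      have h3 : |(n : ℝ)| < 1 := by
        by_contra hc
        push Not at hc
        nlinarith
      have h4 : n = 0 := by
        rw [← Int.cast_abs] at h3
        exact Int.abs_lt_one_iff.1 (by exact_mod_cast h3)
      have h5 : w.im = 0 := by rw [h4] at him; simpa using him
      have : w = 0 := Complex.ext hre h5
      have := hw.1
      simp_all
      linarith
  obtain ⟨M, hM⟩ := hc.exists_bound_of_continuousOn hcont
  exact ⟨M, fun w h1 h2 h3 h4 => hM w ⟨h1, h2, h3, h4⟩⟩

theorem saddleExponent_re (G : ℂ → ℂ) (P : ℝ[X]) (v r τ : ℝ) :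
    (saddleExponent G P v r τ).re =
      v * ((G (Complex.exp (-(Real.exp (-r) * (1 + τ * Complex.I))))).re - P.eval r) := by
  unfold saddleExponent
  rw [Complex.add_re, Complex.re_ofReal_mul, Complex.re_ofReal_mul, Complex.sub_re,
    Complex.ofReal_re]
  simp

/-- Converts a gain of order `r ^ (k + 1)` into one of order `r ^ k * log (1 + τ²)` on the whole
circle. -/
theorem log_one_add_sq_le {r τ : ℝ} (hr : 3 ≤ r) (hτ : |τ| ≤ Real.pi * Real.exp r) :
    Real.log (1 + τ ^ 2) ≤ 4 * r := by
  rw [Real.log_le_iff_le_exp (by positivity)]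
  have h1 : τ ^ 2 ≤ (4 * Real.exp r) ^ 2 := by
    rw [← sq_abs]
    gcongr
    refine hτ.trans ?_
    gcongr
    exact Real.pi_le_four
  have h2 : Real.exp (4 * r) = Real.exp r ^ 4 := by rw [← Real.exp_nat_mul]; norm_num
  have h3 : 8 ≤ Real.exp r := by
    have h4 : Real.exp 3 = Real.exp 1 ^ 3 := by rw [← Real.exp_nat_mul]; norm_num
    have h5 : 2 ≤ Real.exp 1 := by linarith [Real.add_one_le_exp 1]
    have h6 : (2 : ℝ) ^ 3 ≤ Real.exp 1 ^ 3 := by gcongr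
    have := Real.exp_le_exp.2 hr
    linarith
  rw [h2]
  have h4 : 64 ≤ Real.exp r ^ 2 := by nlinarith
  nlinarith

/-- Uniform decay of the integrand on the whole circle. -/
theorem exists_saddleExponent_re_le {k : ℕ} (hk : 1 ≤ k) {c : ℕ → ℝ} {G : ℂ → ℂ}
    (hGcont : ContinuousOn G {t : ℂ | ‖t‖ ≤ 1 ∧ t ≠ 1})
    (hP : (fun w : ℂ => G (Complex.exp (-w)) - aeval (-Complex.log w) (saddlePoly k c))
      =O[𝓝[{w : ℂ | w ≠ 0 ∧ |Complex.arg w| ≤ Real.pi / 2}] 0] (fun w : ℂ => w))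
    {a b : ℝ} (ha : 0 < a) :
    ∃ D R : ℝ, 0 ≤ D ∧ ∀ r, R ≤ r → ∀ v ∈ Set.Icc a b, ∀ τ, |τ| ≤ Real.pi * Real.exp r →
      (saddleExponent G (saddlePoly k c) v r τ).re ≤
        D - a / (16 * (k + 1)) * r ^ k * Real.log (1 + τ ^ 2) := by
  obtain ⟨s₁, hs₁, hnear⟩ := exists_re_aeval_neg_log_le k hk c
  obtain ⟨s₀, hs₀, hb⟩ := exists_saddlePoly_bounds k hk c
  obtain ⟨K, δ₀, hK, hδ₀, hexp⟩ := exists_norm_sub_aeval_le hP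
  -- Since `‖w‖ = exp (-(r - log (1 + τ²) / 2))`, the bound `‖w‖ ≤ e^{-s₁}` is the condition under
  -- which `hnear` applies.
  set δ := min δ₀ (Real.exp (-s₁)) with hδ
  have hδ0 : 0 < δ := lt_min hδ₀ (Real.exp_pos _)
  obtain ⟨M, hM⟩ := exists_norm_le_of_le_norm hGcont hδ0
  set P := saddlePoly k c with hPdef
  -- For `r ≥ N` the bound `M` uses up at most half of the growth of `P`, leaving `P(r) - M ≥ r ^ (k
  -- + 1) / (4 (k + 1))`.
  set N := 4 * (k + 1) * (s₀ ^ (k + 1) / (2 * (k + 1)) - P.eval s₀ + M) with hN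
  refine ⟨|b| * (K * δ), max (max 3 s₀) N, by positivity, fun r hr v hv τ hτ => ?_⟩
  have hr3 : 3 ≤ r := (le_max_left _ _).trans ((le_max_left _ _).trans hr)
  have hrs₀ : s₀ ≤ r := (le_max_right _ _).trans ((le_max_left _ _).trans hr)
  have hrN : N ≤ r := (le_max_right _ _).trans hr
  have hv0 : 0 < v := ha.trans_le hv.1
  have hvb : v ≤ |b| := hv.2.trans (le_abs_self b)
  have hl0 : 0 ≤ Real.log (1 + τ ^ 2) := Real.log_nonneg (by nlinarith [sq_nonneg τ])
  have hrk : 0 ≤ r ^ k := by positivity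
  rw [saddleExponent_re]
  set w : ℂ := (Real.exp (-r) : ℝ) * (1 + τ * Complex.I) with hw
  have hre : w.re = Real.exp (-r) := re_exp_neg_mul_one_add r τ
  have him : w.im = Real.exp (-r) * τ := im_exp_neg_mul_one_add r τ
  rcases le_total ‖w‖ δ with hwδ | hwδ
  · have h1 := hexp w (by rw [hre]; exact Real.exp_pos _) (hwδ.trans (min_le_left _ _))
    rw [hw, neg_log_exp_neg_mul, ← hw] at h1
    have h2 := (Complex.re_le_norm _).trans h1
    rw [Complex.sub_re] at h2
    have h3 : s₁ ≤ r - Real.log (1 + τ ^ 2) / 2 := by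
      have := hwδ.trans (min_le_right _ _)
      rw [hw, norm_exp_neg_mul_one_add_mul_I, Real.exp_le_exp] at this
      linarith
    have h4 := hnear r τ h3
    have h5 : (G (Complex.exp (-w))).re - P.eval r ≤
        K * δ - r ^ k / (8 * (k + 1)) * Real.log (1 + τ ^ 2) := by
      have : K * ‖w‖ ≤ K * δ := by gcongr
      linarith
    calc v * ((G (Complex.exp (-w))).re - P.eval r)
        ≤ v * (K * δ - r ^ k / (8 * (k + 1)) * Real.log (1 + τ ^ 2)) := by gcongr
      _ = v * (K * δ) - v * (r ^ k / (8 * (k + 1)) * Real.log (1 + τ ^ 2)) := by ring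
      _ ≤ |b| * (K * δ) - a / 2 * (r ^ k / (8 * (k + 1)) * Real.log (1 + τ ^ 2)) := by
        gcongr
        linarith [hv.1]
      _ = _ := by field_simp; ring
  · have h1 := hM w hwδ (by rw [hre]; positivity)
      (by rw [hre, Real.exp_le_one_iff]; linarith) (by
        rw [him, abs_mul, abs_of_pos (Real.exp_pos _)]
        calc Real.exp (-r) * |τ| ≤ Real.exp (-r) * (Real.pi * Real.exp r) := by gcongr
          _ = Real.pi * (Real.exp (-r) * Real.exp r) := by ring
          _ = Real.pi := by rw [← Real.exp_add]; simp)
    have h2 := (Complex.re_le_norm _).trans h1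
    have h3 := saddlePoly_sub_ge k c (fun s hs => (hb s hs).1) le_rfl hrs₀
    have h4 : N ≤ r ^ (k + 1) := hrN.trans (le_self_pow₀ (by linarith) (by omega))
    have h5 : (G (Complex.exp (-w))).re - P.eval r ≤ -(r ^ (k + 1) / (4 * (k + 1))) := by
      have h6 : s₀ ^ (k + 1) / (2 * (k + 1)) - P.eval s₀ + M ≤ r ^ (k + 1) / (4 * (k + 1)) := by
        rw [le_div_iff₀ (by positivity)]
        linarith
      have h7 : r ^ (k + 1) / (2 * (k + 1)) = 2 * (r ^ (k + 1) / (4 * (k + 1))) := by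
        field_simp; norm_num
      rw [sub_div, h7] at h3
      linarith
    have h8 := log_one_add_sq_le hr3 hτ
    calc v * ((G (Complex.exp (-w))).re - P.eval r)
        ≤ v * (-(r ^ (k + 1) / (4 * (k + 1)))) := by gcongr
      _ ≤ a * (-(r ^ (k + 1) / (4 * (k + 1)))) := by
        have : 0 ≤ r ^ (k + 1) / (4 * ((k : ℝ) + 1)) := by positivity
        nlinarith [hv.1]
      _ = 0 - a / (16 * (k + 1)) * r ^ k * (4 * r) := by
        rw [pow_succ]; field_simp; ring
      _ ≤ _ := by
        gcongr
        positivity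

/-- The four errors are: the expansion of `G`, the Taylor remainder of `P`, and the replacement of
`log (1 + z)`, `z = iτ`, by `z - z²/2` in the linear term and by `z` in the quadratic term. The term
`z²/2` is why `P'` enters the variance beside `P''`. -/
theorem saddleExponent_add_eq (G : ℂ → ℂ) (P : ℝ[X]) (v r τ : ℝ) :
    saddleExponent G P v r τ
        + ((v * (P.derivative.derivative.eval r + P.derivative.eval r) / 2 * τ ^ 2 : ℝ) : ℂ) =
      v * ((G (Complex.exp (-(Real.exp (-r) * (1 + τ * Complex.I))))
          - aeval (r + -Complex.log (1 + τ * Complex.I) : ℂ) P)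
        + (aeval (r + -Complex.log (1 + τ * Complex.I) : ℂ) P - (P.eval r : ℝ)
          - (P.derivative.eval r : ℝ) * -Complex.log (1 + τ * Complex.I)
          - (P.derivative.derivative.eval r : ℝ) * (-Complex.log (1 + τ * Complex.I)) ^ 2 / 2)
        + -((P.derivative.eval r : ℝ) * (Complex.log (1 + τ * Complex.I)
          - (τ * Complex.I - (τ * Complex.I) ^ 2 / 2)))
        + (P.derivative.derivative.eval r : ℝ) * ((Complex.log (1 + τ * Complex.I) - τ * Complex.I)
          * (Complex.log (1 + τ * Complex.I) + τ * Complex.I) / 2)) := by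
  unfold saddleExponent
  have hI := Complex.I_sq
  push_cast
  linear_combination ((v : ℂ) * (P.derivative.eval r : ℝ) * τ ^ 2 / 2
    + (v : ℂ) * (P.derivative.derivative.eval r : ℝ) * τ ^ 2 / 2) * hI

/-- Quadratic approximation of the exponent near the saddle point. -/
theorem exists_saddleExponent_add_le {k : ℕ} (hk : 1 ≤ k) {c : ℕ → ℝ} {G : ℂ → ℂ}
    (hP : (fun w : ℂ => G (Complex.exp (-w)) - aeval (-Complex.log w) (saddlePoly k c))
      =O[𝓝[{w : ℂ | w ≠ 0 ∧ |Complex.arg w| ≤ Real.pi / 2}] 0] (fun w : ℂ => w))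
    {a b : ℝ} (ha : 0 < a) :
    ∃ C R : ℝ, 0 ≤ C ∧ ∀ r, R ≤ r → ∀ v ∈ Set.Icc a b, ∀ τ, |τ| ≤ 1 / 2 →
      ‖saddleExponent G (saddlePoly k c) v r τ
        + ((v * ((saddlePoly k c).derivative.derivative.eval r
            + (saddlePoly k c).derivative.eval r) / 2 * τ ^ 2 : ℝ) : ℂ)‖
        ≤ C * (r ^ k * |τ| ^ 3 + Real.exp (-r)) := by
  obtain ⟨s₀, hs₀, hb⟩ := exists_saddlePoly_bounds k hk c
  obtain ⟨K, δ, hK, hδ, hexp⟩ := exists_norm_sub_aeval_le hP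
  obtain ⟨C, hC, hT⟩ := exists_taylor_three_le k c
  refine ⟨|b| * (2 * K + 8 * C + 3), max s₀ (-Real.log (δ / 2)), by positivity,
    fun r hr v hv τ hτ => ?_⟩
  have hrs₀ : s₀ ≤ r := (le_max_left _ _).trans hr
  have hr1 : 1 ≤ r := hs₀.trans hrs₀
  have hρ : Real.exp (-r) ≤ δ / 2 := by
    rw [← Real.exp_log (half_pos hδ), Real.exp_le_exp]
    linarith [(le_max_right _ _).trans hr]
  have hv0 : 0 < v := ha.trans_le hv.1
  have hvb : v ≤ |b| := hv.2.trans (le_abs_self b)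
  have hrk : 0 ≤ r ^ k := by positivity
  obtain ⟨hb1, hb2, hb3⟩ := hb r hrs₀
  set z : ℂ := τ * Complex.I with hz
  have hzn : ‖z‖ = |τ| := by simp [hz]
  have hz2 : ‖z‖ ≤ 1 / 2 := by rw [hzn]; exact hτ
  set L := Complex.log (1 + z) with hL
  have hLn : ‖L‖ ≤ 2 * |τ| := hzn ▸ norm_log_one_add_le_two_mul hz2
  rw [saddleExponent_add_eq, norm_mul, Complex.norm_real, Real.norm_eq_abs, abs_of_pos hv0]
  have h1 : ‖G (Complex.exp (-((Real.exp (-r) : ℝ) * (1 + z))))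
      - aeval ((r : ℂ) + -L) (saddlePoly k c)‖ ≤ 2 * K * Real.exp (-r) := by
    have hwn : ‖((Real.exp (-r) : ℝ) * (1 + z) : ℂ)‖ ≤ 2 * Real.exp (-r) := by
      rw [norm_mul, Complex.norm_real, Real.norm_eq_abs, abs_of_pos (Real.exp_pos _), mul_comm]
      gcongr
      refine (norm_add_le _ _).trans ?_
      rw [norm_one]; linarith
    have := hexp ((Real.exp (-r) : ℝ) * (1 + z))
      (by rw [hz, re_exp_neg_mul_one_add]; exact Real.exp_pos _) (by linarith)
    rw [hz, neg_log_exp_neg_mul, ← hz, sub_eq_add_neg] at this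
    refine this.trans ?_
    calc _ ≤ K * (2 * Real.exp (-r)) := by gcongr
      _ = _ := by ring
  have h2 := hT r hr1 (-L) (by rw [norm_neg]; linarith)
  rw [norm_neg] at h2
  have h2' : C * r ^ k * ‖L‖ ^ 3 ≤ 8 * C * (r ^ k * |τ| ^ 3) := by
    calc _ ≤ C * r ^ k * (2 * |τ|) ^ 3 := by gcongr
      _ = _ := by ring
  have h3 : ‖-((((saddlePoly k c).derivative.eval r : ℝ) : ℂ) * (L - (z - z ^ 2 / 2)))‖ ≤
      2 * (r ^ k * |τ| ^ 3) := by
    rw [norm_neg, norm_mul, Complex.norm_real, Real.norm_eq_abs, abs_of_nonneg (by linarith),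
      ← mul_assoc]
    gcongr
    rw [← hzn]
    exact norm_log_one_add_sub_sub_le hz2
  have h4 : ‖(((saddlePoly k c).derivative.derivative.eval r : ℝ) : ℂ)
      * ((L - z) * (L + z) / 2)‖ ≤ r ^ k * |τ| ^ 3 := by
    rw [norm_mul, Complex.norm_real, Real.norm_eq_abs, norm_div, norm_mul, Complex.norm_ofNat]
    have h5 : ‖L - z‖ ≤ |τ| ^ 2 := hzn ▸ norm_log_one_add_sub_le hz2
    have h6 : ‖L + z‖ ≤ 3 * |τ| := by
      refine (norm_add_le _ _).trans ?_
      rw [hzn]; linarith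
    calc _ ≤ r ^ k / 4 * (|τ| ^ 2 * (3 * |τ|) / 2) := by gcongr
      _ = 3 / 8 * (r ^ k * |τ| ^ 3) := by ring
      _ ≤ 1 * (r ^ k * |τ| ^ 3) := by
        gcongr
        norm_num
      _ = _ := one_mul _
  have hX : 0 ≤ r ^ k * |τ| ^ 3 := by positivity
  have hE := Real.exp_pos (-r)
  calc v * _ ≤ |b| * (2 * K * Real.exp (-r) + 8 * C * (r ^ k * |τ| ^ 3)
        + 2 * (r ^ k * |τ| ^ 3) + r ^ k * |τ| ^ 3) := by
        refine mul_le_mul hvb ?_ (norm_nonneg _) (abs_nonneg _)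
        refine (norm_add_le _ _).trans (add_le_add ?_ h4)
        refine (norm_add_le _ _).trans (add_le_add ?_ h3)
        exact (norm_add_le _ _).trans (add_le_add h1 (h2.trans h2'))
    _ ≤ |b| * ((2 * K + 8 * C + 3) * (r ^ k * |τ| ^ 3 + Real.exp (-r))) := by
        gcongr
        nlinarith [mul_nonneg hK hX, mul_nonneg hC hE.le]
    _ = _ := by ring

/-! ### Gaussian approximation of the integral -/

theorem exists_sqrt_pow_le_exp (k : ℕ) :
    ∃ R : ℝ, ∀ r, R ≤ r → Real.exp (-r) ≤ 1 / Real.sqrt (r ^ k) := by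
  have h := (Real.tendsto_pow_mul_exp_neg_atTop_nhds_zero k).eventually_le_const one_pos
  obtain ⟨R, hR⟩ := eventually_atTop.1 h
  refine ⟨max R 1, fun r hr => ?_⟩
  have h1 := hR r ((le_max_left _ _).trans hr)
  have hr1 : 1 ≤ r := (le_max_right _ _).trans hr
  have hk : 0 < r ^ k := by positivity
  rw [le_div_iff₀ (Real.sqrt_pos.2 hk)]
  have h2 : Real.sqrt (r ^ k) ≤ r ^ k := by
    rw [Real.sqrt_le_left hk.le]
    exact le_self_pow₀ (one_le_pow₀ hr1) (by norm_num)
  have := mul_le_mul_of_nonneg_left h2 (Real.exp_pos (-r)).le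
  linarith

/-- Pointwise Gaussian approximation of the integrand on the whole real line of scaled angles. -/
theorem exists_norm_exp_saddleExponent_sub_le {k : ℕ} (hk : 1 ≤ k) {c : ℕ → ℝ} {G : ℂ → ℂ}
    (hGcont : ContinuousOn G {t : ℂ | ‖t‖ ≤ 1 ∧ t ≠ 1})
    (hP : (fun w : ℂ => G (Complex.exp (-w)) - aeval (-Complex.log w) (saddlePoly k c))
      =O[𝓝[{w : ℂ | w ≠ 0 ∧ |Complex.arg w| ≤ Real.pi / 2}] 0] (fun w : ℂ => w))
    {a b : ℝ} (ha : 0 < a) :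
    ∃ B R : ℝ, 0 ≤ B ∧ ∀ r, R ≤ r → ∀ v ∈ Set.Icc a b, ∀ A : ℝ,
      A = v * ((saddlePoly k c).derivative.derivative.eval r
        + (saddlePoly k c).derivative.eval r) →
      (∀ τ, |τ| ≤ Real.pi * Real.exp r →
        ‖Complex.exp (saddleExponent G (saddlePoly k c) v r τ) - Real.exp (-(A / 2) * τ ^ 2)‖ ≤
          B / Real.sqrt (r ^ k) * (1 + Real.sqrt (r ^ k) ^ 2 * τ ^ 2)⁻¹) ∧
      (∀ τ, Real.pi * Real.exp r ≤ |τ| → Real.exp (-(A / 2) * τ ^ 2) ≤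
          B / Real.sqrt (r ^ k) * (1 + Real.sqrt (r ^ k) ^ 2 * τ ^ 2)⁻¹) := by
  obtain ⟨s₀, hs₀, hb⟩ := exists_saddlePoly_bounds k hk c
  obtain ⟨R₁, hR₁⟩ := exists_sqrt_pow_le_exp k
  obtain ⟨D, R₂, hD, hdecay⟩ := exists_saddleExponent_re_le hk hGcont hP (b := b) ha
  obtain ⟨C, R₃, hC, hnear⟩ := exists_saddleExponent_add_le hk hP (b := b) ha
  set κ := min 1 (a / (16 * (k + 1))) with hκ
  have hκ0 : 0 < κ := lt_min one_pos (by positivity)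
  -- The first summand serves `|τ| ≤ 1/2`; the second serves larger `|τ|`, where `8 |τ|³ ≥ 1` lets
  -- the crude bound pass as a cubic error.
  set E := Real.exp D * C + 8 * (Real.exp D + 1) with hE
  have hE0 : 0 ≤ E := by positivity
  refine ⟨E * (2 * (3 / κ) ^ 3), max (max s₀ (3 / κ)) (max R₁ (max R₂ R₃)), by positivity,
    fun r hr v hv A hA => ?_⟩
  simp only [max_le_iff] at hr
  obtain ⟨⟨hrs₀, hrκ⟩, hrR₁, hrR₂, hrR₃⟩ := hr
  have hr1 : 1 ≤ r := hs₀.trans hrs₀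
  have hX1 : 1 ≤ r ^ k := one_le_pow₀ hr1
  have hX0 : 0 ≤ r ^ k := zero_le_one.trans hX1
  have hY0 : 0 < Real.sqrt (r ^ k) := Real.sqrt_pos.2 (by positivity)
  have hY2 : Real.sqrt (r ^ k) ^ 2 = r ^ k := Real.sq_sqrt hX0
  have hv0 : 0 < v := ha.trans_le hv.1
  obtain ⟨hb1, hb2, hb3⟩ := hb r hrs₀
  rw [abs_le] at hb3
  have hρ := Real.exp_pos (-r)
  set F : ℝ → ℝ := fun τ => Real.exp (-(κ * r ^ k) * Real.log (1 + τ ^ 2)) with hF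
  have hF0 : ∀ τ, 0 < F τ := fun τ => Real.exp_pos _
  have hcubic : ∀ τ, E * ((r ^ k * |τ| ^ 3 + Real.exp (-r)) * F τ) ≤
      E * (2 * (3 / κ) ^ 3) / Real.sqrt (r ^ k) * (1 + Real.sqrt (r ^ k) ^ 2 * τ ^ 2)⁻¹ := by
    intro τ
    have hq : 3 ≤ κ * Real.sqrt (r ^ k) ^ 2 := by
      rw [hY2, ← div_le_iff₀' hκ0]
      exact hrκ.trans (le_self_pow₀ hr1 (by omega))
    have h := cubic_mul_exp_neg_log_le (τ := τ) hκ0 (min_le_left _ _) hY0 hq (hR₁ r hrR₁)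
    have h' := mul_le_mul_of_nonneg_left h hE0
    simp only [hY2, hF] at h' ⊢
    exact h'.trans (le_of_eq (by ring))
  have hl0 : ∀ τ : ℝ, 0 ≤ Real.log (1 + τ ^ 2) := fun τ =>
    Real.log_nonneg (by nlinarith [sq_nonneg τ])
  have hgauss : ∀ τ, Real.exp (-(A / 2) * τ ^ 2) ≤ F τ := by
    intro τ
    have h1 : a / 4 * r ^ k ≤ A := by
      rw [hA]
      calc a / 4 * r ^ k = a * (r ^ k / 4) := by ring
        _ ≤ _ := mul_le_mul hv.1 (by linarith) (by positivity) hv0.le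
    have h2 : Real.log (1 + τ ^ 2) ≤ τ ^ 2 := by
      have := Real.log_le_sub_one_of_pos (x := 1 + τ ^ 2) (by positivity)
      linarith
    have h3 : κ ≤ a / 8 := by
      refine (min_le_right _ _).trans ?_
      gcongr
      have : (0 : ℝ) ≤ k := k.cast_nonneg
      linarith
    have h4 : κ * r ^ k ≤ A / 2 := by nlinarith
    have h5 : κ * r ^ k * Real.log (1 + τ ^ 2) ≤ A / 2 * τ ^ 2 := by
      have := hl0 τ
      have : 0 ≤ A / 2 := le_trans (by positivity) h4
      gcongr
    exact Real.exp_le_exp.2 (by linarith)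
  have hre : ∀ τ, |τ| ≤ Real.pi * Real.exp r →
      (saddleExponent G (saddlePoly k c) v r τ).re ≤
        D + -(κ * r ^ k) * Real.log (1 + τ ^ 2) := by
    intro τ hτ
    refine (hdecay r hrR₂ v hv τ hτ).trans ?_
    have : κ * r ^ k * Real.log (1 + τ ^ 2) ≤
        a / (16 * (k + 1)) * r ^ k * Real.log (1 + τ ^ 2) := by
      have := hl0 τ
      gcongr
      exact min_le_right _ _
    linarith
  have hfar : ∀ τ : ℝ, 1 / 2 ≤ |τ| →
      1 ≤ 8 * (r ^ k * |τ| ^ 3 + Real.exp (-r)) := by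
    intro τ hτ
    have h1 : (1 / 2 : ℝ) ^ 3 ≤ |τ| ^ 3 := by gcongr
    have h2 : 1 * |τ| ^ 3 ≤ r ^ k * |τ| ^ 3 := by gcongr
    norm_num at h1
    linarith
  refine ⟨fun τ hτ => le_trans ?_ (hcubic τ), fun τ hτ => le_trans ?_ (hcubic τ)⟩
  · have hD' := Real.exp_pos D
    rcases le_total |τ| (1 / 2) with hτ2 | hτ2
    · have h1 := norm_exp_sub_exp_le (m := D + -(κ * r ^ k) * Real.log (1 + τ ^ 2)) (hre τ hτ)
        (y := ((-(A / 2) * τ ^ 2 : ℝ) : ℂ)) (by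
          rw [Complex.ofReal_re]
          have := Real.exp_le_exp.1 (hgauss τ)
          linarith)
      have h2 := hnear r hrR₃ v hv τ hτ2
      rw [← hA] at h2
      have e : saddleExponent G (saddlePoly k c) v r τ - ((-(A / 2) * τ ^ 2 : ℝ) : ℂ) =
          saddleExponent G (saddlePoly k c) v r τ + ((A / 2 * τ ^ 2 : ℝ) : ℂ) := by
        push_cast; ring
      rw [e, Real.exp_add, ← Complex.ofReal_exp] at h1
      refine h1.trans ?_
      calc _ ≤ Real.exp D * F τ * (C * (r ^ k * |τ| ^ 3 + Real.exp (-r))) := by gcongr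
        _ = Real.exp D * C * ((r ^ k * |τ| ^ 3 + Real.exp (-r)) * F τ) := by ring
        _ ≤ _ := by
          have := hF0 τ
          gcongr
          rw [hE]
          linarith
    · have h1 : ‖Complex.exp (saddleExponent G (saddlePoly k c) v r τ)‖ ≤ Real.exp D * F τ := by
        rw [Complex.norm_exp, hF, ← Real.exp_add]
        exact Real.exp_le_exp.2 (hre τ hτ)
      have h2 := (norm_sub_le (Complex.exp (saddleExponent G (saddlePoly k c) v r τ))
        (Real.exp (-(A / 2) * τ ^ 2) : ℝ))
      rw [Complex.norm_real, Real.norm_eq_abs, abs_of_pos (Real.exp_pos _)] at h2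
      have h3 := hF0 τ
      calc _ ≤ Real.exp D * F τ + F τ := h2.trans (add_le_add h1 (hgauss τ))
        _ = (Real.exp D + 1) * (1 * F τ) := by ring
        _ ≤ (Real.exp D + 1) * (8 * (r ^ k * |τ| ^ 3 + Real.exp (-r)) * F τ) := by
          gcongr
          exact hfar τ hτ2
        _ = 8 * (Real.exp D + 1) * ((r ^ k * |τ| ^ 3 + Real.exp (-r)) * F τ) := by ring
        _ ≤ _ := by
          gcongr
          rw [hE]
          linarith [mul_nonneg hD'.le hC]
  · have hτ2 : 1 / 2 ≤ |τ| := by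
      refine le_trans ?_ hτ
      have h1 := Real.add_one_le_exp r
      nlinarith [Real.pi_gt_three]
    have h3 := hF0 τ
    have hD' := Real.exp_pos D
    calc _ ≤ 1 * F τ := by rw [one_mul]; exact hgauss τ
      _ ≤ 8 * (r ^ k * |τ| ^ 3 + Real.exp (-r)) * F τ := by
        gcongr
        exact hfar τ hτ2
      _ = 8 * ((r ^ k * |τ| ^ 3 + Real.exp (-r)) * F τ) := by ring
      _ ≤ _ := by
        gcongr
        rw [hE]
        linarith [mul_nonneg hD'.le hC]

/-- The Cauchy integral relative to the Gaussian integral. -/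
theorem exists_integral_exp_saddleExponent_eq {k : ℕ} (hk : 1 ≤ k) {c : ℕ → ℝ} {G : ℂ → ℂ}
    (hGcont : ContinuousOn G {t : ℂ | ‖t‖ ≤ 1 ∧ t ≠ 1})
    (hP : (fun w : ℂ => G (Complex.exp (-w)) - aeval (-Complex.log w) (saddlePoly k c))
      =O[𝓝[{w : ℂ | w ≠ 0 ∧ |Complex.arg w| ≤ Real.pi / 2}] 0] (fun w : ℂ => w))
    {a b : ℝ} (ha : 0 < a) :
    ∃ C R : ℝ, 0 ≤ C ∧ ∀ r, R ≤ r → ∀ v ∈ Set.Icc a b, ∀ A : ℝ,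
      A = v * ((saddlePoly k c).derivative.derivative.eval r
        + (saddlePoly k c).derivative.eval r) →
      0 < A ∧ ∃ ε : ℂ, ‖ε‖ ≤ C / Real.sqrt (r ^ k) ∧
        ∫ τ in (-(Real.pi * Real.exp r))..(Real.pi * Real.exp r),
          Complex.exp (saddleExponent G (saddlePoly k c) v r τ) =
            (Real.sqrt (2 * Real.pi / A) : ℝ) * (1 + ε) := by
  obtain ⟨s₀, hs₀, hb⟩ := exists_saddlePoly_bounds k hk c
  obtain ⟨B, R, hB, h⟩ := exists_norm_exp_saddleExponent_sub_le hk hGcont hP (b := b) ha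
  have hpi := Real.pi_pos
  refine ⟨B * Real.pi * Real.sqrt (3 * |b| / (2 * Real.pi)), max s₀ R, by positivity,
    fun r hr v hv A hA => ?_⟩
  obtain ⟨h1, h2⟩ := h r ((le_max_right _ _).trans hr) v hv A hA
  have hrs₀ : s₀ ≤ r := (le_max_left _ _).trans hr
  have hr1 : 1 ≤ r := hs₀.trans hrs₀
  have hX0 : 0 < r ^ k := by positivity
  have hY0 : 0 < Real.sqrt (r ^ k) := Real.sqrt_pos.2 hX0
  have hv0 : 0 < v := ha.trans_le hv.1
  have hvb : v ≤ |b| := hv.2.trans (le_abs_self b)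
  obtain ⟨hb1, hb2, hb3⟩ := hb r hrs₀
  rw [abs_le] at hb3
  have hA0 : 0 < A := by
    rw [hA]; exact mul_pos hv0 (by linarith)
  have hAb : A ≤ 3 * |b| * r ^ k := by
    rw [hA]
    calc _ ≤ |b| * (3 * r ^ k) := mul_le_mul hvb (by linarith) (by linarith) (abs_nonneg _)
      _ = _ := by ring
  have hmain := norm_integral_sub_gaussian_le (by positivity) hA0 hY0
    (continuous_saddleExponent hGcont (saddlePoly k c) v r).cexp h1 h2
  set J := ∫ τ in (-(Real.pi * Real.exp r))..(Real.pi * Real.exp r),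
          Complex.exp (saddleExponent G (saddlePoly k c) v r τ) with hJ
  set g := Real.sqrt (2 * Real.pi / A) with hg
  have hg0 : 0 < g := Real.sqrt_pos.2 (by positivity)
  have hgc : (g : ℂ) ≠ 0 := by exact_mod_cast hg0.ne'
  refine ⟨hA0, (J - g) / g, ?_, by field_simp; ring⟩
  rw [norm_div, Complex.norm_real, Real.norm_eq_abs, abs_of_pos hg0]
  -- As `A = O(r ^ k)`, passing to the relative error costs only one of the two factors `1 / √(r ^
  -- k)`.
  have hginv : g⁻¹ ≤ Real.sqrt (3 * |b| / (2 * Real.pi)) * Real.sqrt (r ^ k) := by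
    rw [hg, ← Real.sqrt_inv, ← Real.sqrt_mul (by positivity), inv_div]
    refine Real.sqrt_le_sqrt ?_
    rw [div_mul_eq_mul_div]
    gcongr
  calc ‖J - g‖ / g = ‖J - g‖ * g⁻¹ := div_eq_mul_inv _ _
    _ ≤ B / Real.sqrt (r ^ k) * (Real.pi / Real.sqrt (r ^ k)) *
        (Real.sqrt (3 * |b| / (2 * Real.pi)) * Real.sqrt (r ^ k)) := by gcongr
    _ = _ := by field_simp

/-! ### Existence and size of the saddle points -/

/-- For large `n` every saddle point is large. -/
theorem exists_forall_isSaddle_le (P : ℝ[X]) {a b : ℝ} (ha : 0 < a) (R : ℝ) :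
    ∃ N : ℕ, ∀ n : ℕ, N ≤ n → ∀ v ∈ Set.Icc a b, ∀ r : ℝ, IsSaddle P v n r → R ≤ r := by
  -- A saddle point satisfies `n = v P'(r) e^r`. The right side stays bounded on `(-∞, R]` because
  -- `P'(r) e^r → 0` at `-∞`.
  have hbdd : ∃ M : ℝ, ∀ r, r ≤ R → |P.derivative.eval r| * Real.exp r ≤ M := by
    have hlim : Tendsto (fun x : ℝ => (P.derivative.comp (-X)).eval x * Real.exp (-x))
        atTop (𝓝 0) := by
      simp_rw [Real.exp_neg, ← div_eq_mul_inv]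
      exact Polynomial.tendsto_div_exp_atTop _
    have hlim' := hlim.abs.eventually_le_const (u := 1) (by simp)
    obtain ⟨x₀, hx₀⟩ := eventually_atTop.1 hlim'
    obtain ⟨M, hM⟩ := (isCompact_Icc (a := -x₀) (b := R)).exists_bound_of_continuousOn
      (f := fun r => P.derivative.eval r * Real.exp r)
      (P.derivative.continuous.mul Real.continuous_exp).continuousOn
    refine ⟨max M 1, fun r hr => ?_⟩
    rw [← abs_of_pos (Real.exp_pos r), ← abs_mul]
    rcases le_total (-x₀) r with h | h
    · exact (hM r ⟨h, hr⟩).trans (le_max_left _ _)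
    · have := hx₀ (-r) (by linarith)
      simp only [eval_comp, eval_neg, eval_X, neg_neg] at this
      exact this.trans (le_max_right _ _)
  obtain ⟨M, hM⟩ := hbdd
  obtain ⟨N, hN⟩ := exists_nat_gt (|b| * M)
  refine ⟨N, fun n hn v hv r hr => ?_⟩
  by_contra hc
  push Not at hc
  have h1 := hM r hc.le
  have hv0 : 0 < v := ha.trans_le hv.1
  have hvb : v ≤ |b| := hv.2.trans (le_abs_self b)
  have h2 : (n : ℝ) = v * (P.derivative.eval r * Real.exp r) := by
    have h3 : v * P.derivative.eval r = n * Real.exp (-r) := hr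
    rw [← mul_assoc, h3, mul_assoc, ← Real.exp_add]; simp
  have h3 : (n : ℝ) ≤ |b| * M := by
    rw [h2]
    refine mul_le_mul hvb (le_trans ?_ h1) ?_ (abs_nonneg _)
    · gcongr; exact le_abs_self _
    · have : (0 : ℝ) ≤ n := n.cast_nonneg
      rw [h2] at this
      exact nonneg_of_mul_nonneg_right this hv0
  have h4 : (N : ℝ) ≤ n := by exact_mod_cast hn
  linarith

theorem exists_isSaddle (k : ℕ) (hk : 1 ≤ k) (c : ℕ → ℝ) {a b : ℝ} (ha : 0 < a) :
    ∃ N : ℕ, ∀ n : ℕ, N ≤ n → ∀ v ∈ Set.Icc a b, ∃ r : ℝ, IsSaddle (saddlePoly k c) v n r := by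
  obtain ⟨s₀, hs₀, hb⟩ := exists_saddlePoly_bounds k hk c
  set f : ℝ → ℝ := fun r => (saddlePoly k c).derivative.eval r * Real.exp r with hf
  obtain ⟨N, hN⟩ := exists_nat_ge (|b| * |f s₀|)
  refine ⟨N, fun n hn v hv => ?_⟩
  have hv0 : 0 < v := ha.trans_le hv.1
  have hvb : v ≤ |b| := hv.2.trans (le_abs_self b)
  have hcont : Continuous fun r => v * f r :=
    ((saddlePoly k c).derivative.continuous.mul Real.continuous_exp).const_mul v
  -- At this point `P'(r₁) ≥ r₁ / 2` and `e^{r₁} ≥ 1` already give `v P'(r₁) e^{r₁} ≥ n`.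
  set r₁ := max s₀ (2 * n / v) with hr₁
  have h1 : v * f s₀ ≤ n := by
    have h2 : (N : ℝ) ≤ n := by exact_mod_cast hn
    calc v * f s₀ ≤ v * |f s₀| := by gcongr; exact le_abs_self _
      _ ≤ |b| * |f s₀| := by gcongr
      _ ≤ n := hN.trans h2
  have h2 : (n : ℝ) ≤ v * f r₁ := by
    have hr1 : 1 ≤ r₁ := hs₀.trans (le_max_left _ _)
    have h3 := (hb r₁ (le_max_left _ _)).1
    have h4 : r₁ ≤ r₁ ^ k := le_self_pow₀ hr1 (by omega)
    have h5 : 1 ≤ Real.exp r₁ := Real.one_le_exp (by linarith)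
    have h6 : 2 * n / v ≤ r₁ := le_max_right _ _
    calc (n : ℝ) = v * ((2 * n / v) / 2 * 1) := by field_simp
      _ ≤ v * (r₁ / 2 * Real.exp r₁) := by gcongr
      _ ≤ v * f r₁ := by
        simp only [hf]
        gcongr
        linarith
  obtain ⟨r, -, hr⟩ := intermediate_value_Icc (le_max_left s₀ (2 * n / v)) hcont.continuousOn
    ⟨h1, h2⟩
  refine ⟨r, ?_⟩
  simp only [hf] at hr
  unfold IsSaddle
  rw [← hr, mul_assoc, mul_assoc, ← Real.exp_add]; simp

/-- Large saddle points satisfy `log n ≤ 2 r`. -/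
theorem exists_log_le_two_mul (k : ℕ) (hk : 1 ≤ k) (c : ℕ → ℝ) (a b : ℝ) :
    ∃ R : ℝ, ∀ r, R ≤ r → ∀ v ∈ Set.Icc a b, ∀ n : ℕ, 1 ≤ n → IsSaddle (saddlePoly k c) v n r →
      Real.log n ≤ 2 * r := by
  obtain ⟨s₀, hs₀, hb⟩ := exists_saddlePoly_bounds k hk c
  have hlim := ((Real.tendsto_pow_mul_exp_neg_atTop_nhds_zero k).const_mul
    (|b| * 2)).eventually_le_const (u := 1) (by simp)
  obtain ⟨R, hR⟩ := eventually_atTop.1 hlim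
  refine ⟨max s₀ R, fun r hr v hv n hn hs => ?_⟩
  have hrs₀ : s₀ ≤ r := (le_max_left _ _).trans hr
  have hr1 : 1 ≤ r := hs₀.trans hrs₀
  have hvb : v ≤ |b| := hv.2.trans (le_abs_self b)
  have h3 : v * (saddlePoly k c).derivative.eval r = n * Real.exp (-r) := hs
  obtain ⟨hb1, hb2, -⟩ := hb r hrs₀
  have hX0 : 0 < r ^ k := by positivity
  have h4 : (n : ℝ) * Real.exp (-r) ≤ |b| * (2 * r ^ k) := by
    rw [← h3]
    exact mul_le_mul hvb hb2 (by linarith) (abs_nonneg _)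
  have h5 := hR r ((le_max_right _ _).trans hr)
  have hn0 : (0 : ℝ) < n := by exact_mod_cast hn
  rw [Real.log_le_iff_le_exp hn0]
  have h6 : (n : ℝ) * Real.exp (-r) * Real.exp (-r) ≤ 1 := by
    calc _ ≤ |b| * (2 * r ^ k) * Real.exp (-r) := by gcongr
      _ = |b| * 2 * (r ^ k * Real.exp (-r)) := by ring
      _ ≤ 1 := h5
  rw [mul_assoc, ← Real.exp_add, show -r + -r = -(2 * r) by ring, Real.exp_neg,
    ← div_eq_mul_inv, div_le_one (Real.exp_pos _)] at h6
  exact h6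

/-! ### Assembly -/

/-- By the saddle equation the radicand equals `2πA`. -/
theorem saddleMainTerm_eq {P : ℝ[X]} {v r A : ℝ} {n : ℕ} (hr : IsSaddle P v n r)
    (hA : A = v * (P.derivative.derivative.eval r + P.derivative.eval r)) (hA0 : 0 < A) :
    saddleMainTerm P v n r = Real.exp (-r) / (2 * Real.pi) *
      Real.exp (v * P.eval r + n * Real.exp (-r)) * Real.sqrt (2 * Real.pi / A) := by
  have h3 : v * P.derivative.eval r = n * Real.exp (-r) := hr
  have hpi := Real.pi_pos
  have e : 2 * Real.pi * v * P.derivative.derivative.eval r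
      + 2 * Real.pi * (n : ℝ) * Real.exp (-r) = 2 * Real.pi * A := by
    rw [mul_assoc (2 * Real.pi) (n : ℝ), ← h3, hA]; ring
  unfold saddleMainTerm
  rw [e, Real.sqrt_mul (by positivity), Real.sqrt_div (by positivity), Real.exp_neg]
  have h1 : Real.sqrt (2 * Real.pi) * Real.sqrt (2 * Real.pi) = 2 * Real.pi :=
    Real.mul_self_sqrt (by positivity)
  have h2 : 0 < Real.sqrt (2 * Real.pi) := Real.sqrt_pos.2 (by positivity)
  have h4 : 0 < Real.sqrt A := Real.sqrt_pos.2 hA0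
  generalize Real.sqrt (2 * Real.pi) = s at *
  rw [← h1]
  field_simp

theorem saddleExpansionOn_Icc {θ : ℕ → ℂ} {k : ℕ} (hk : 1 ≤ k) {c : ℕ → ℝ}
    (hrad : gThetaRadius θ = 1) {G : ℂ → ℂ} (hG : ∀ t : ℂ, ‖t‖ < 1 → G t = gTheta θ t)
    (hGcont : ContinuousOn G {t : ℂ | ‖t‖ ≤ 1 ∧ t ≠ 1})
    (hP : (fun w : ℂ => G (Complex.exp (-w)) - aeval (-Complex.log w) (saddlePoly k c))
      =O[𝓝[{w : ℂ | w ≠ 0 ∧ |Complex.arg w| ≤ Real.pi / 2}] 0] (fun w : ℂ => w))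
    {a b : ℝ} (ha : 0 < a) : SaddleExpansionOn θ k (saddlePoly k c) (Set.Icc a b) := by
  obtain ⟨C, R₁, hC, hint⟩ := exists_integral_exp_saddleExponent_eq hk hGcont hP (b := b) ha
  obtain ⟨R₂, hlog⟩ := exists_log_le_two_mul k hk c a b
  obtain ⟨N₁, hN₁⟩ := exists_forall_isSaddle_le (saddlePoly k c) (b := b) ha
    (max (max R₁ R₂) 1)
  obtain ⟨N₂, hN₂⟩ := exists_isSaddle k hk c (b := b) ha
  -- The factor `2 ^ (k / 2)` comes from `log n ≤ 2 r`; `n ≥ 2` makes `log n` positive.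
  refine ⟨C * 2 ^ ((k : ℝ) / 2), max (max N₁ N₂) 2, fun n hn v hv => ?_⟩
  simp only [max_le_iff] at hn
  obtain ⟨⟨hn₁, hn₂⟩, hn2⟩ := hn
  refine ⟨hN₂ n hn₂ v hv, fun r hr => ?_⟩
  have hR := hN₁ n hn₁ v hv r hr
  simp only [max_le_iff] at hR
  obtain ⟨⟨hr₁, hr₂⟩, hr1⟩ := hR
  obtain ⟨hA0, ε, hε, hJ⟩ := hint r hr₁ v hv _ rfl
  refine ⟨ε, hε.trans ?_, ?_⟩
  · have hl := hlog r hr₂ v hv n (by omega) hr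
    have hl0 : 0 < Real.log n := Real.log_pos (by exact_mod_cast hn2)
    have e1 : Real.sqrt (r ^ k) = r ^ ((k : ℝ) / 2) := by
      rw [Real.sqrt_eq_rpow, ← Real.rpow_natCast, ← Real.rpow_mul (by linarith)]
      congr 1; ring
    have e2 : Real.log n ^ (-(k : ℝ) / 2) = (Real.log n ^ ((k : ℝ) / 2))⁻¹ := by
      rw [neg_div, Real.rpow_neg hl0.le]
    have h1 : Real.log n ^ ((k : ℝ) / 2) ≤ 2 ^ ((k : ℝ) / 2) * r ^ ((k : ℝ) / 2) := by
      rw [← Real.mul_rpow (by norm_num) (by linarith)]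
      exact Real.rpow_le_rpow hl0.le hl (by positivity)
    have h2 : 0 < Real.log n ^ ((k : ℝ) / 2) := Real.rpow_pos_of_pos hl0 _
    have h3 : 0 < r ^ ((k : ℝ) / 2) := Real.rpow_pos_of_pos (by linarith) _
    rw [e1, e2, mul_assoc, div_eq_mul_inv]
    gcongr
    rw [← div_eq_mul_inv, inv_eq_one_div, div_le_div_iff₀ h3 h2, one_mul]
    exact h1
  · rw [extractCoeff_eq_integral hrad hG hr, hJ, saddleMainTerm_eq hr rfl hA0]
    push_cast
    ring

end

theorem theorem2p4 (θ : ℕ → ℂ) (k : ℕ) (hk : 1 ≤ k) (c : ℕ → ℝ)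
    -- `g_Θ` has radius of convergence `1`
    (hrad : gThetaRadius θ = 1)
    -- `G` is the continuous extension of `g_Θ` to the punctured closed unit disc
    (G : ℂ → ℂ) (hG : ∀ t : ℂ, ‖t‖ < 1 → G t = gTheta θ t)
    (hGcont : ContinuousOn G {t : ℂ | ‖t‖ ≤ 1 ∧ t ≠ 1})
    -- `g_Θ(e^{-w}) = P(-log w) + O(w)` as `w → 0`, `w ≠ 0`, `|arg w| ≤ π / 2`
    (hP : (fun w : ℂ => G (Complex.exp (-w)) -
        Polynomial.aeval (-Complex.log w) (saddlePoly k c))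
      =O[𝓝[{w : ℂ | w ≠ 0 ∧ |Complex.arg w| ≤ Real.pi / 2}] 0] (fun w : ℂ => w)) :
    (∀ v : ℝ, 0 < v → SaddleExpansionOn θ k (saddlePoly k c) {v}) ∧
    (∀ v₁ v₂ : ℝ, 1 ≤ v₁ → v₁ < v₂ →
      SaddleExpansionOn θ k (saddlePoly k c) (Set.Icc v₁ v₂)) := by
  refine ⟨fun v hv => ?_, fun v₁ v₂ hv₁ _ =>
    saddleExpansionOn_Icc hk hrad hG hGcont hP (one_pos.trans_le hv₁)⟩
  -- A single `v > 0` is the degenerate interval `[v, v]`; the uniform statement needs only a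
  -- positive left endpoint.
  rw [← Set.Icc_self]
  exact saddleExpansionOn_Icc hk hrad hG hGcont hP hv
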